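/- Let $n,m,k$ be natural numbers, let $L$ be a self-adjoint complex $n\times n$ matrix, let $B_1,\dots,B_k$ be self-adjoint complex $m\times m$ matrices, and let $H_1,\dots,H_k$ be complex $m\times n$ matrices satisfying \[ H_1^*H_1+\cdots+H_k^*H_k=I_n , \] where $I_n$ is the $n\times n$ identity matrix. Then \[ \operatorname{Tr}\exp\Bigl(L+\sum_{i=1}^k H_i^*B_iH_i\Bigr)\le \operatorname{Tr}\Bigl(\exp(L)\sum_{i=1}^k H_i^*\exp(B_i)H_i\Bigr). \] -/

import Mathlib

open scoped Matrix ComplexOrder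

set_option linter.unusedSectionVars false

open Filter Topology

/-! ### Lie product formula in a Banach algebra -/

section LieProduct

/-! Stacking the `H i` gives an isometry `W`, and the sum becomes the compression `Wᴴ * B * W` of a
block-diagonal `B`, so one isometry suffices. Put `D t = W L Wᴴ + t (1 - W Wᴴ)`, which compresses to
`L` for every real `t`. Compression does not raise the trace of the exponential (Jensen), so
Golden–Thompson gives `Tr exp (L + Wᴴ B W) ≤ Tr exp (D t + B) ≤ Tr (exp (D t) exp B)`. The right
side is the desired bound plus `exp t` times a constant; let `t → -∞`. Golden–Thompson itself
follows from trace inequalities for `2 ^ k`-th powers and the Lie product formula. -/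

theorem norm_pow_sub_pow_le_of_norm_le {R : Type*} [NormedRing R] [NormOneClass R] {x y : R}
    {c : ℝ} (hc : 1 ≤ c) (hx : ‖x‖ ≤ c) (hy : ‖y‖ ≤ c) (n : ℕ) :
    ‖x ^ n - y ^ n‖ ≤ n * ‖x - y‖ * c ^ n := by
  have hc0 : 0 ≤ c := zero_le_one.trans hc
  induction n with
  | zero => simp
  | succ n ih =>
    have h : x ^ (n + 1) - y ^ (n + 1) = (x ^ n - y ^ n) * x + y ^ n * (x - y) := by
      rw [pow_succ, pow_succ]; noncomm_ring
    have h1 : ‖(x ^ n - y ^ n) * x‖ ≤ n * ‖x - y‖ * c ^ n * c :=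
      (norm_mul_le _ _).trans (by gcongr)
    have h2 : ‖y ^ n * (x - y)‖ ≤ c ^ n * ‖x - y‖ :=
      (norm_mul_le _ _).trans (by
        gcongr
        exact (norm_pow_le _ _).trans (by gcongr))
    have h3 : c ^ n * ‖x - y‖ ≤ c ^ n * ‖x - y‖ * c :=
      le_mul_of_one_le_right (by positivity) hc
    calc ‖x ^ (n + 1) - y ^ (n + 1)‖ ≤ n * ‖x - y‖ * c ^ n * c + c ^ n * ‖x - y‖ * c := by
          rw [h]
          exact (norm_add_le _ _).trans (add_le_add h1 (h2.trans h3))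
      _ = (n + 1 : ℕ) * ‖x - y‖ * c ^ (n + 1) := by push_cast; ring

variable {R : Type*} [NormedRing R] [NormedAlgebra ℝ R]

theorem NormedSpace.norm_exp_le_exp_norm [NormOneClass R] (x : R) :
    ‖NormedSpace.exp x‖ ≤ Real.exp ‖x‖ := by
  rw [Real.exp_eq_exp_ℝ, NormedSpace.exp_eq_tsum ℝ, NormedSpace.exp_eq_tsum ℝ]
  have hs : Summable fun n : ℕ => ((n.factorial : ℝ)⁻¹) • ‖x‖ ^ n :=
    NormedSpace.expSeries_summable' ‖x‖
  refine tsum_of_norm_bounded hs.hasSum fun n => ?_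
  rw [norm_smul, Real.norm_of_nonneg (by positivity), smul_eq_mul]
  gcongr
  exact norm_pow_le _ _

/-- The **Lie product formula** in a real Banach algebra. -/
theorem NormedSpace.tendsto_exp_mul_exp_pow [NormOneClass R] [CompleteSpace R] (A B : R) :
    Tendsto (fun N : ℕ => (NormedSpace.exp ((N : ℝ)⁻¹ • A) * NormedSpace.exp ((N : ℝ)⁻¹ • B)) ^ N)
      atTop (𝓝 (NormedSpace.exp (A + B))) := by
  let _ : NormedAlgebra ℚ R := NormedAlgebra.restrictScalars ℚ ℝ R
  let f : ℝ → R := fun t =>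
    NormedSpace.exp (t • A) * NormedSpace.exp (t • B) - NormedSpace.exp (t • (A + B))
  -- The two sides agree to first order at `0`, so `N • f (1 / N) → 0`, which absorbs the factor `N`
  -- from the power estimate.
  have hf : HasDerivAt f 0 0 := by
    have h (C : R) : HasDerivAt (fun t : ℝ => NormedSpace.exp (t • C)) C 0 := by
      simpa using hasDerivAt_exp_smul_const (𝕂 := ℝ) C (0 : ℝ)
    exact (((h A).mul (h B)).sub (h (A + B))).congr_deriv (by simp)
  have hf0 : f 0 = 0 := by simp [f]
  have hlim : Tendsto (fun N : ℕ => (N : ℝ) • f ((N : ℝ)⁻¹)) atTop (𝓝 0) := by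
    have h1 : Tendsto (fun N : ℕ => (N : ℝ)⁻¹) atTop (𝓝[≠] 0) := by
      refine tendsto_nhdsWithin_iff.2 ⟨tendsto_inv_atTop_nhds_zero_nat, ?_⟩
      filter_upwards [eventually_ne_atTop 0] with N hN
      simpa using hN
    have h2 := (hasDerivAt_iff_tendsto_slope_zero.1 hf).comp h1
    simpa [Function.comp_def, hf0] using h2
  rw [tendsto_iff_norm_sub_tendsto_zero]
  have hbound : Tendsto (fun N : ℕ => ‖(N : ℝ) • f ((N : ℝ)⁻¹)‖ * Real.exp (‖A‖ + ‖B‖))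
      atTop (𝓝 0) := by
    simpa using hlim.norm.mul_const (Real.exp (‖A‖ + ‖B‖))
  refine squeeze_zero' (Eventually.of_forall fun N => norm_nonneg _) ?_ hbound
  filter_upwards [eventually_ne_atTop 0] with N hN
  have hN' : (N : ℝ) ≠ 0 := by exact_mod_cast hN
  set t : ℝ := (N : ℝ)⁻¹ with ht
  have ht0 : 0 ≤ t := by positivity
  have hpow : NormedSpace.exp (t • (A + B)) ^ N = NormedSpace.exp (A + B) := by
    rw [← NormedSpace.exp_nsmul, ← Nat.cast_smul_eq_nsmul ℝ, smul_smul, ht, mul_inv_cancel₀ hN',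
      one_smul]
  have hnorm (C : R) : ‖t • C‖ = t * ‖C‖ := by rw [norm_smul, Real.norm_of_nonneg ht0]
  have h1 : ‖NormedSpace.exp (t • A) * NormedSpace.exp (t • B)‖
      ≤ Real.exp (t * (‖A‖ + ‖B‖)) := by
    rw [mul_add, Real.exp_add, ← hnorm, ← hnorm]
    exact (norm_mul_le _ _).trans (mul_le_mul (norm_exp_le_exp_norm _) (norm_exp_le_exp_norm _)
      (norm_nonneg _) (Real.exp_nonneg _))
  have h2 : ‖NormedSpace.exp (t • (A + B))‖ ≤ Real.exp (t * (‖A‖ + ‖B‖)) := by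
    refine (norm_exp_le_exp_norm _).trans (Real.exp_le_exp.2 ?_)
    rw [hnorm]
    gcongr
    exact norm_add_le _ _
  have h3 := norm_pow_sub_pow_le_of_norm_le (Real.one_le_exp (by positivity)) h1 h2 N
  rw [hpow, ← Real.exp_nat_mul, ← mul_assoc, ht, mul_inv_cancel₀ hN', one_mul] at h3
  rw [norm_smul, Real.norm_natCast]
  exact h3

end LieProduct

namespace Matrix

/-! ### Golden–Thompson inequality -/

section GoldenThompson

variable {n : Type*} [Fintype n]

theorem trace_mul_pow_comm [DecidableEq n] {R : Type*} [CommSemiring R] (C D : Matrix n n R) (k : ℕ) :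
    ((C * D) ^ k).trace = ((D * C) ^ k).trace := by
  cases k with
  | zero => simp
  | succ k =>
    have h : C * (D * C) ^ k = (C * D) ^ k * C :=
      (SemiconjBy.pow_right (show SemiconjBy C (D * C) (C * D) by
        simp [SemiconjBy, mul_assoc]) k)
    rw [pow_succ, ← mul_assoc, ← h, trace_mul_comm, ← mul_assoc, ← pow_succ']

theorem re_trace_mul_self_nonneg {A : Matrix n n ℂ} : 0 ≤ (Aᴴ * A).trace.re :=
  (Complex.nonneg_iff.1 (posSemidef_conjTranspose_mul_self A).trace_nonneg).1

variable [DecidableEq n]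

theorem re_trace_sq_le (X : Matrix n n ℂ) : (X ^ 2).trace.re ≤ (Xᴴ * X).trace.re := by
  have h := re_trace_mul_self_nonneg (A := X - Xᴴ)
  have h1 : (Xᴴ * Xᴴ).trace.re = (X * X).trace.re := by
    rw [← conjTranspose_mul, trace_conjTranspose]; simp
  have h2 : (X * Xᴴ).trace.re = (Xᴴ * X).trace.re := by rw [trace_mul_comm]
  simp only [conjTranspose_sub, conjTranspose_conjTranspose, sub_mul, mul_sub, trace_sub,
    Complex.sub_re, h1, h2] at h
  rw [sq]
  linarith

theorem IsHermitian.re_trace_mul_le {U V : Matrix n n ℂ} (hU : U.IsHermitian)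
    (hV : V.IsHermitian) :
    2 * (U * V).trace.re ≤ (U ^ 2).trace.re + (V ^ 2).trace.re := by
  have h := re_trace_mul_self_nonneg (A := U - V)
  have h2 : (V * U).trace.re = (U * V).trace.re := by rw [trace_mul_comm]
  simp only [conjTranspose_sub, hU.eq, hV.eq, sub_mul, mul_sub, trace_sub,
    Complex.sub_re, h2] at h
  rw [sq, sq]
  linarith

/-- The two claims feed each other, hence the joint induction. The first is applied to `X ^ 2` or `A
* B`; cyclicity turns the result into a power of `(Xᴴ * X) * (X * Xᴴ)` or `A ^ 2 * B ^ 2`, to which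
the second applies. -/
theorem re_trace_pow_two_pow_le (k : ℕ) :
    (∀ X : Matrix n n ℂ, (X ^ 2 ^ (k + 1)).trace.re ≤ ((Xᴴ * X) ^ 2 ^ k).trace.re) ∧
    ∀ A B : Matrix n n ℂ, A.IsHermitian → B.IsHermitian →
      ((A * B) ^ 2 ^ k).trace.re ≤ (A ^ 2 ^ k * B ^ 2 ^ k).trace.re := by
  induction k with
  | zero => exact ⟨fun X => by simpa using re_trace_sq_le X, fun A B _ _ => by simp⟩
  | succ k ih =>
    obtain ⟨hS, hG⟩ := ih
    refine ⟨fun X => ?_, fun A B hA hB => ?_⟩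
    · have hU := isHermitian_conjTranspose_mul_self X
      have hV := isHermitian_mul_conjTranspose_self X
      have h1 := hS (X ^ 2)
      have h2 : (((X ^ 2)ᴴ * X ^ 2) ^ 2 ^ k).trace = (((Xᴴ * X) * (X * Xᴴ)) ^ 2 ^ k).trace := by
        rw [sq, conjTranspose_mul, mul_assoc, trace_mul_pow_comm]
        simp only [mul_assoc]
      -- `h3` separates the factors and `h4` bounds their product by two squares, whose traces
      -- coincide by cyclicity.
      have h3 := hG _ _ hU hV
      have h4 := (hU.pow (2 ^ k)).re_trace_mul_le (hV.pow (2 ^ k))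
      rw [← pow_mul, ← pow_mul, ← pow_succ, trace_mul_pow_comm X Xᴴ] at h4
      rw [h2, ← pow_mul, ← pow_succ'] at h1
      linarith
    · have h1 := hS (A * B)
      have h2 : (((A * B)ᴴ * (A * B)) ^ 2 ^ k).trace = ((A ^ 2 * B ^ 2) ^ 2 ^ k).trace := by
        rw [conjTranspose_mul, hA.eq, hB.eq, mul_assoc, trace_mul_pow_comm]
        simp only [mul_assoc, sq]
      have h3 := hG _ _ (hA.pow 2) (hB.pow 2)
      rw [← pow_mul, ← pow_mul, ← pow_succ'] at h3
      rw [h2] at h1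
      exact h1.trans h3

/-- The **Golden–Thompson inequality**. -/
theorem IsHermitian.re_trace_exp_add_le {A B : Matrix n n ℂ} (hA : A.IsHermitian)
    (hB : B.IsHermitian) :
    (NormedSpace.exp (A + B)).trace.re ≤ (NormedSpace.exp A * NormedSpace.exp B).trace.re := by
  -- The Lie formula needs `‖1‖ = 1`, hence a nonempty index type.
  cases isEmpty_or_nonempty n
  · simp [trace]
  have hlie : Tendsto (fun N : ℕ =>
      (NormedSpace.exp ((N : ℝ)⁻¹ • A) * NormedSpace.exp ((N : ℝ)⁻¹ • B)) ^ N)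
      atTop (𝓝 (NormedSpace.exp (A + B))) := by
    open scoped Norms.Operator in exact NormedSpace.tendsto_exp_mul_exp_pow A B
  have htr : Continuous fun M : Matrix n n ℂ => M.trace.re :=
    Complex.continuous_re.comp continuous_id.matrix_trace
  have hlim := ((htr.tendsto _).comp hlie).comp
    (tendsto_pow_atTop_atTop_of_one_lt (one_lt_two : (1 : ℕ) < 2))
  refine le_of_tendsto hlim (Eventually.of_forall fun k => ?_)
  have hpow (C : Matrix n n ℂ) :
      NormedSpace.exp (((2 ^ k : ℕ) : ℝ)⁻¹ • C) ^ 2 ^ k = NormedSpace.exp C := by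
    rw [← exp_nsmul, ← Nat.cast_smul_eq_nsmul ℝ, smul_smul, mul_inv_cancel₀ (by positivity),
      one_smul]
  have hsmul {C : Matrix n n ℂ} (hC : C.IsHermitian) (t : ℝ) : (t • C).IsHermitian := by
    rw [IsHermitian, conjTranspose_smul, hC.eq, star_trivial]
  have h := (re_trace_pow_two_pow_le k).2 _ _ (hsmul hA ((2 ^ k : ℕ) : ℝ)⁻¹).exp
    (hsmul hB ((2 ^ k : ℕ) : ℝ)⁻¹).exp
  rwa [hpow, hpow] at h

end GoldenThompson

/-! ### Compression and dilation by an isometry -/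

section Isometry

theorem conjTranspose_mul_diagonal_mul_apply_self {n N : Type*} [Fintype N]
    [DecidableEq N] (K : Matrix N n ℂ) (d : N → ℝ) (i : n) :
    (Kᴴ * diagonal (fun j => (d j : ℂ)) * K) i i =
      ((∑ j, Complex.normSq (K j i) * d j : ℝ) : ℂ) := by
  rw [mul_apply]
  push_cast
  refine Finset.sum_congr rfl fun j _ => ?_
  rw [mul_diagonal, conjTranspose_apply, mul_right_comm, Complex.normSq_eq_conj_mul_self,
    starRingEnd_apply]

variable {n N : Type*} [Fintype n]

theorem IsHermitian.im_trace_mul_eq_zero {U V : Matrix n n ℂ} (hU : U.IsHermitian)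
    (hV : V.IsHermitian) : (U * V).trace.im = 0 := by
  have h : star (U * V).trace = (U * V).trace := by
    rw [← trace_conjTranspose, conjTranspose_mul, hU.eq, hV.eq, trace_mul_comm]
  exact Complex.conj_eq_iff_im.1 h

variable [DecidableEq n] [Fintype N] [DecidableEq N]

theorem IsHermitian.exists_unitary_conj_diagonal {A : Matrix n n ℂ} (hA : A.IsHermitian) :
    ∃ (U : Matrix n n ℂ) (d : n → ℝ), Uᴴ * U = 1 ∧ U * Uᴴ = 1 ∧
      A = U * diagonal (fun i => (d i : ℂ)) * Uᴴ :=
  ⟨hA.eigenvectorUnitary, hA.eigenvalues, Unitary.coe_star_mul_self _,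
    Unitary.coe_mul_star_self _, by
      conv_lhs => rw [hA.spectral_theorem, Unitary.conjStarAlgAut_apply]
      rfl⟩

theorem exp_unitary_conj_diagonal {U : Matrix n n ℂ} (hU : Uᴴ * U = 1) (d : n → ℝ) :
    NormedSpace.exp (U * diagonal (fun i => (d i : ℂ)) * Uᴴ) =
      U * diagonal (fun i => (Real.exp (d i) : ℂ)) * Uᴴ := by
  have hU' : U * Uᴴ = 1 := mul_eq_one_comm.1 hU
  have h := exp_units_conj (⟨U, Uᴴ, hU', hU⟩ : (Matrix n n ℂ)ˣ) (diagonal fun i => (d i : ℂ))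
  simp only [Units.inv_mk] at h
  rw [h, exp_diagonal]
  congr 3
  ext i
  rw [Pi.coe_exp, Complex.ofReal_exp, Complex.exp_eq_exp_ℂ]

theorem re_trace_unitary_conj_diagonal {U : Matrix n n ℂ} (hU : Uᴴ * U = 1) (d : n → ℝ) :
    (U * diagonal (fun i => (d i : ℂ)) * Uᴴ).trace.re = ∑ i, d i := by
  rw [trace_mul_comm, ← mul_assoc, hU, one_mul, trace_diagonal, Complex.re_sum]
  simp

theorem sum_normSq_col_of_isometry {K : Matrix N n ℂ} (hK : Kᴴ * K = 1) (i : n) :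
    ∑ j, Complex.normSq (K j i) = 1 := by
  have h := conjTranspose_mul_diagonal_mul_apply_self K (fun _ => 1) i
  simp only [Complex.ofReal_one, diagonal_one, Matrix.mul_one, hK, one_apply_eq, mul_one] at h
  exact_mod_cast h.symm

theorem sum_normSq_row_le_of_isometry {K : Matrix N n ℂ} (hK : Kᴴ * K = 1) (j : N) :
    ∑ i, Complex.normSq (K j i) ≤ 1 := by
  -- `1 - K * Kᴴ` is an orthogonal projection, so its diagonal is nonnegative.
  have hP : (1 - K * Kᴴ)ᴴ * (1 - K * Kᴴ) = 1 - K * Kᴴ := by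
    have h : K * Kᴴ * (K * Kᴴ) = K * Kᴴ := by
      rw [Matrix.mul_assoc, ← Matrix.mul_assoc Kᴴ, hK, Matrix.one_mul]
    simp [Matrix.sub_mul, Matrix.mul_sub, h]
  have h := (posSemidef_conjTranspose_mul_self (1 - K * Kᴴ)).diag_nonneg (i := j)
  rw [hP] at h
  have h1 : (K * Kᴴ) j j = ((∑ i, Complex.normSq (K j i) : ℝ) : ℂ) := by
    have := conjTranspose_mul_diagonal_mul_apply_self Kᴴ (fun _ => 1) j
    simpa using this
  rw [sub_apply, h1, one_apply_eq] at h
  have := (Complex.nonneg_iff.1 h).1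
  simpa using this

/-- Compressing a Hermitian matrix by an isometry does not increase the trace of its
exponential. -/
theorem IsHermitian.re_trace_exp_compression_le {X : Matrix N N ℂ} (hX : X.IsHermitian)
    {H : Matrix N n ℂ} (hH : Hᴴ * H = 1) :
    (NormedSpace.exp (Hᴴ * X * H)).trace.re ≤ (NormedSpace.exp X).trace.re := by
  obtain ⟨U, d, hU, hU', hd⟩ :=
    (isHermitian_conjTranspose_mul_mul H hX).exists_unitary_conj_diagonal
  obtain ⟨V, e, hV, hV', he⟩ := hX.exists_unitary_conj_diagonal
  -- `K` is `H` in the two eigenbases; its squared moduli are the Jensen weights expressing each `d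
  -- i` as an average of the `e j`.
  set K : Matrix N n ℂ := Vᴴ * H * U with hKdef
  have hK : Kᴴ * K = 1 := by
    calc Kᴴ * K = Uᴴ * (Hᴴ * (V * Vᴴ) * H) * U := by
          simp only [hKdef, conjTranspose_mul, conjTranspose_conjTranspose, Matrix.mul_assoc]
      _ = 1 := by rw [hV', Matrix.mul_one, hH, Matrix.mul_one, hU]
  have hdiag : Kᴴ * diagonal (fun j => (e j : ℂ)) * K = diagonal fun i => (d i : ℂ) := by
    calc Kᴴ * diagonal (fun j => (e j : ℂ)) * K
        = Uᴴ * (Hᴴ * (V * diagonal (fun j => (e j : ℂ)) * Vᴴ) * H) * U := by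
          simp only [hKdef, conjTranspose_mul, conjTranspose_conjTranspose, Matrix.mul_assoc]
      _ = (Uᴴ * U) * diagonal (fun i => (d i : ℂ)) * (Uᴴ * U) := by
          rw [← he, hd]; simp only [Matrix.mul_assoc]
      _ = _ := by rw [hU, Matrix.one_mul, Matrix.mul_one]
  have hdi (i : n) : d i = ∑ j, Complex.normSq (K j i) * e j := by
    have h := conjTranspose_mul_diagonal_mul_apply_self K e i
    rw [hdiag, diagonal_apply_eq] at h
    exact_mod_cast h
  rw [hd, exp_unitary_conj_diagonal hU, re_trace_unitary_conj_diagonal hU, he,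
    exp_unitary_conj_diagonal hV, re_trace_unitary_conj_diagonal hV]
  calc ∑ i, Real.exp (d i) ≤ ∑ i, ∑ j, Complex.normSq (K j i) * Real.exp (e j) := by
        refine Finset.sum_le_sum fun i _ => ?_
        rw [hdi]
        simpa using convexOn_exp.map_sum_le (t := Finset.univ) (p := e)
          (fun j _ => Complex.normSq_nonneg (K j i)) (sum_normSq_col_of_isometry hK i)
          (fun _ _ => Set.mem_univ _)
    _ = ∑ j, (∑ i, Complex.normSq (K j i)) * Real.exp (e j) := by
        rw [Finset.sum_comm]
        simp only [Finset.sum_mul]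
    _ ≤ ∑ j, Real.exp (e j) := Finset.sum_le_sum fun j _ =>
        mul_le_of_le_one_left (Real.exp_nonneg _) (sum_normSq_row_le_of_isometry hK j)

/-- The ring homomorphism `(A, z) ↦ H A Hᴴ + z (1 - H Hᴴ)` attached to an isometry `H`. -/
def isometryDilation (H : Matrix N n ℂ) (hH : Hᴴ * H = 1) :
    Matrix n n ℂ × ℂ →+* Matrix N N ℂ where
  toFun p := H * p.1 * Hᴴ + p.2 • (1 - H * Hᴴ)
  map_one' := by simp
  map_zero' := by simp
  map_add' p q := by
    simp only [Prod.fst_add, Prod.snd_add, Matrix.mul_add, Matrix.add_mul, add_smul]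
    abel
  map_mul' p q := by
    have h1 (C : Matrix n N ℂ) : Hᴴ * (H * C) = C := by
      rw [← Matrix.mul_assoc, hH, Matrix.one_mul]
    simp [Matrix.mul_add, Matrix.add_mul, Matrix.mul_sub, Matrix.sub_mul, Matrix.mul_assoc, h1,
      smul_smul, mul_comm]

/-- A continuous ring homomorphism commutes with `exp`. -/
theorem exp_isometryDilation (H : Matrix N n ℂ) (hH : Hᴴ * H = 1) (A : Matrix n n ℂ) (z : ℂ) :
    NormedSpace.exp (H * A * Hᴴ + z • (1 - H * Hᴴ)) =
      H * NormedSpace.exp A * Hᴴ + Complex.exp z • (1 - H * Hᴴ) := by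
  have hc : Continuous (isometryDilation H hH) := by
    change Continuous fun p : Matrix n n ℂ × ℂ => H * p.1 * Hᴴ + p.2 • (1 - H * Hᴴ)
    fun_prop
  have h : isometryDilation H hH (NormedSpace.exp (A, z)) =
      NormedSpace.exp (isometryDilation H hH (A, z)) := by
    open scoped Norms.Operator in exact NormedSpace.map_exp _ hc _
  have h1 : (NormedSpace.exp (A, z)).1 = NormedSpace.exp A := by
    open scoped Norms.Operator in exact Prod.fst_exp (A, z)
  have h2 : (NormedSpace.exp (A, z)).2 = NormedSpace.exp z := by
    open scoped Norms.Operator in exact Prod.snd_exp (A, z)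
  change H * (NormedSpace.exp (A, z)).1 * Hᴴ + (NormedSpace.exp (A, z)).2 • (1 - H * Hᴴ) = _ at h
  rw [h1, h2, ← Complex.exp_eq_exp_ℂ] at h
  exact h.symm

/-- The Golden–Thompson inequality for the compression of one summand by an isometry. -/
theorem IsHermitian.re_trace_exp_add_compression_le {L : Matrix n n ℂ} (hL : L.IsHermitian)
    {B : Matrix N N ℂ} (hB : B.IsHermitian) {H : Matrix N n ℂ} (hH : Hᴴ * H = 1) :
    (NormedSpace.exp (L + Hᴴ * B * H)).trace.re ≤
      (NormedSpace.exp L * (Hᴴ * NormedSpace.exp B * H)).trace.re := by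
  have hP : (1 - H * Hᴴ).IsHermitian :=
    isHermitian_one.sub (isHermitian_mul_conjTranspose_self H)
  have hD (t : ℝ) : (H * L * Hᴴ + (t : ℂ) • (1 - H * Hᴴ)).IsHermitian := by
    refine (isHermitian_mul_mul_conjTranspose H hL).add ?_
    rw [IsHermitian, conjTranspose_smul, hP.eq]
    simp
  have hcomp (t : ℝ) : Hᴴ * (H * L * Hᴴ + (t : ℂ) • (1 - H * Hᴴ) + B) * H =
      L + Hᴴ * B * H := by
    have h1 (C : Matrix n n ℂ) : Hᴴ * (H * C) = C := by
      rw [← Matrix.mul_assoc, hH, Matrix.one_mul]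
    simp [Matrix.mul_add, Matrix.add_mul, Matrix.mul_sub, Matrix.sub_mul, Matrix.mul_assoc, h1,
      hH]
  have hle (t : ℝ) : (NormedSpace.exp (L + Hᴴ * B * H)).trace.re ≤
      (NormedSpace.exp L * (Hᴴ * NormedSpace.exp B * H)).trace.re +
        Real.exp t * ((1 - H * Hᴴ) * NormedSpace.exp B).trace.re := by
    have h1 := ((hD t).add hB).re_trace_exp_compression_le hH
    have h2 := (hD t).re_trace_exp_add_le hB
    rw [hcomp] at h1
    refine (h1.trans h2).trans_eq ?_
    rw [exp_isometryDilation H hH, Matrix.add_mul, trace_add, Complex.add_re, Matrix.smul_mul,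
      trace_smul, ← Complex.ofReal_exp, smul_eq_mul, Complex.re_ofReal_mul]
    congr 2
    rw [Matrix.mul_assoc, Matrix.mul_assoc, trace_mul_comm]
    simp only [Matrix.mul_assoc]
  have hlim := (Real.tendsto_exp_atBot.mul_const
    ((1 - H * Hᴴ) * NormedSpace.exp B).trace.re).const_add
    (NormedSpace.exp L * (Hᴴ * NormedSpace.exp B * H)).trace.re
  rw [zero_mul, add_zero] at hlim
  exact ge_of_tendsto hlim (Eventually.of_forall hle)

end Isometry

end Matrix

theorem mainTheorem4 (n m k : ℕ)
    (H : Fin k → Matrix (Fin m) (Fin n) ℂ)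
    (hH : ∑ i, (H i)ᴴ * H i = 1)
    (L : Matrix (Fin n) (Fin n) ℂ) (hL : L.IsHermitian)
    (B : Fin k → Matrix (Fin m) (Fin m) ℂ) (hB : ∀ i, (B i).IsHermitian) :
    (NormedSpace.exp (L + ∑ i, (H i)ᴴ * B i * H i)).trace ≤
      (NormedSpace.exp L * ∑ i, (H i)ᴴ * NormedSpace.exp (B i) * H i).trace := by
  let W : Matrix (Fin m × Fin k) (Fin n) ℂ := Matrix.of fun p j => H p.2 p.1 j
  have hW (C : Fin k → Matrix (Fin m) (Fin m) ℂ) :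
      Wᴴ * Matrix.blockDiagonal C * W = ∑ i, (H i)ᴴ * C i * H i := by
    ext a b
    simp [W, Matrix.mul_apply, Matrix.sum_apply, Fintype.sum_prod_type_right,
      Matrix.blockDiagonal_apply]
  have hW1 : Wᴴ * W = 1 := by
    have h := hW fun _ => 1
    simp only [Matrix.mul_one, hH] at h
    rwa [show (fun _ : Fin k => (1 : Matrix (Fin m) (Fin m) ℂ)) = 1 from rfl,
      Matrix.blockDiagonal_one, Matrix.mul_one] at h
  have hBd : (Matrix.blockDiagonal B).IsHermitian := by
    rw [Matrix.IsHermitian, Matrix.blockDiagonal_conjTranspose]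
    exact congrArg _ (funext fun i => (hB i).eq)
  have hexp : Wᴴ * NormedSpace.exp (Matrix.blockDiagonal B) * W =
      ∑ i, (H i)ᴴ * NormedSpace.exp (B i) * H i := by
    rw [Matrix.exp_blockDiagonal, hW]
    have h : NormedSpace.exp B = fun i => NormedSpace.exp (B i) := by
      open scoped Matrix.Norms.Operator in exact Pi.exp_def B
    rw [h]
  rw [← hW, ← hexp, Complex.le_def]
  -- The complex order also demands equal imaginary parts; both vanish, as traces of products of
  -- Hermitian matrices.
  refine ⟨hL.re_trace_exp_add_compression_le hBd hW1, ?_⟩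
  have h1 := (hL.add (Matrix.isHermitian_conjTranspose_mul_mul W hBd)).exp
  have h2 := h1.im_trace_mul_eq_zero Matrix.isHermitian_one
  rw [Matrix.mul_one] at h2
  rw [h2, hL.exp.im_trace_mul_eq_zero (Matrix.isHermitian_conjTranspose_mul_mul W hBd.exp)]
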